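/- Let $(X,\mathcal B,\mu)$ be a measure space with $0<\mu(X)<\infty$, and let $f:X\to X$ be an injective bimeasurable map (that is, $f(B)\in\mathcal B$ and $f^{-1}(B)\in\mathcal B$ for every $B\in\mathcal B$) for which there is a constant $c>0$ such that $\mu(f(B))\ge c\,\mu(B)$ for every $B\in\mathcal B$. Let $1\le p<\infty$, and let $T_f:\varphi\mapsto\varphi\circ f$ be the composition operator, a continuous linear operator on the (real or complex) space $L^p(X,\mathcal B,\mu)$. Then $T_f$ is densely Li-Yorke chaotic if and only if $T_f$ is topologically transitive. Here a continuous self-map $g$ of a metric space $(M,d)$ is called densely Li-Yorke chaotic if there is an uncountable dense set $S\subset M$ such that $$\liminf_{n\to\infty} d(g^n(x),g^n(y))=0\quad\text{and}\quad \limsup_{n\to\infty} d(g^n(x),g^n(y))>0$$ for all distinct $x,y\in S$; and $g$ is called topologically transitive if for all nonempty open sets $U,V\subset M$ there is an integer $n\ge 0$ with $g^n(U)\cap V\neq\emptyset$. -/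

import Mathlib

open MeasureTheory Filter
open scoped ENNReal NNReal

/-- A pair `(x, y)` is a Li-Yorke pair for `g` if
`liminf d(gⁿ x, gⁿ y) = 0` and `limsup d(gⁿ x, gⁿ y) > 0`. The distance is taken with values in
`[0, ∞]`, so that both limits exist as lattice limits even for unbounded orbits. -/
def IsLiYorkePair {M : Type*} [MetricSpace M] (g : M → M) (x y : M) : Prop :=
  liminf (fun n : ℕ => edist (g^[n] x) (g^[n] y)) atTop = 0 ∧
    0 < limsup (fun n : ℕ => edist (g^[n] x) (g^[n] y)) atTop

/-- An uncountable set, each pair of distinct points of which is a Li-Yorke pair. -/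
def IsScrambledSet {M : Type*} [MetricSpace M] (g : M → M) (S : Set M) : Prop :=
  ¬ S.Countable ∧ ∀ x ∈ S, ∀ y ∈ S, x ≠ y → IsLiYorkePair g x y

/-- `g` has a dense scrambled set. -/
def IsDenselyLiYorkeChaotic {M : Type*} [MetricSpace M] (g : M → M) : Prop :=
  ∃ S : Set M, IsScrambledSet g S ∧ Dense S

/-- Topological transitivity of the map `g`: for all nonempty open `U`, `V`
some iterate of `U` meets `V`. -/
def IsTopTransitive {M : Type*} [TopologicalSpace M] (g : M → M) : Prop :=
  ∀ U V : Set M, IsOpen U → U.Nonempty → IsOpen V → V.Nonempty →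
    ∃ n : ℕ, ((g^[n] '' U) ∩ V).Nonempty

/-- `f` is bimeasurable: images and preimages of measurable sets are measurable. -/
def IsBimeasurable {X : Type*} [MeasurableSpace X] (f : X → X) : Prop :=
  ∀ B : Set X, MeasurableSet B → MeasurableSet (f '' B) ∧ MeasurableSet (f ⁻¹' B)

/-- There is a constant `c > 0` with `μ (f(B)) ≥ c μ(B)` for every measurable `B`. -/
def HasLowerImageBound {X : Type*} [MeasurableSpace X] (μ : Measure X) (f : X → X) : Prop :=
  ∃ c : ℝ≥0, 0 < c ∧ ∀ B : Set X, MeasurableSet B → (c : ℝ≥0∞) * μ B ≤ μ (f '' B)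

section CompOp

variable {X : Type*} [MeasurableSpace X] {μ : Measure X} {f : X → X}

theorem IsBimeasurable.measurable (hf : IsBimeasurable f) : Measurable f :=
  fun B hB => (hf B hB).2

theorem HasLowerImageBound.exists_map_le (hf : IsBimeasurable f) (hc : HasLowerImageBound μ f) :
    ∃ C : ℝ≥0∞, C ≠ ∞ ∧ μ.map f ≤ C • μ := by
  obtain ⟨c, hc0, h⟩ := hc
  have hc0' : (c : ℝ≥0∞) ≠ 0 := by exact_mod_cast hc0.ne'
  refine ⟨(c : ℝ≥0∞)⁻¹, ENNReal.inv_ne_top.2 hc0', Measure.le_iff.2 fun s hs => ?_⟩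
  rw [Measure.map_apply hf.measurable hs, Measure.smul_apply, smul_eq_mul,
    ← ENNReal.mul_le_iff_le_inv hc0' ENNReal.coe_ne_top]
  exact (h _ (hf s hs).2).trans (measure_mono (Set.image_preimage_subset f s))

theorem HasLowerImageBound.quasiMeasurePreserving (hf : IsBimeasurable f)
    (hc : HasLowerImageBound μ f) : Measure.QuasiMeasurePreserving f μ μ := by
  obtain ⟨C, -, hC⟩ := hc.exists_map_le hf
  exact ⟨hf.measurable, (Measure.absolutelyContinuous_of_le hC).trans
    Measure.smul_absolutelyContinuous⟩

variable {𝕜 : Type*} [RCLike 𝕜] {p : ℝ≥0∞}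

theorem HasLowerImageBound.memLp_comp (hf : IsBimeasurable f) (hc : HasLowerImageBound μ f)
    {φ : X → 𝕜} (hφ : MemLp φ p μ) : MemLp (φ ∘ f) p μ := by
  obtain ⟨C, hC, hle⟩ := hc.exists_map_le hf
  exact (hφ.of_measure_le_smul hC hle).comp_of_map hf.measurable.aemeasurable

theorem HasLowerImageBound.exists_norm_bound (hf : IsBimeasurable f)
    (hc : HasLowerImageBound μ f) :
    ∃ K : ℝ, ∀ φ : Lp 𝕜 p μ,
      ‖(hc.memLp_comp hf (Lp.memLp φ)).toLp (φ ∘ f)‖ ≤ K * ‖φ‖ := by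
  obtain ⟨C, hC, hle⟩ := hc.exists_map_le hf
  refine ⟨(C ^ (1 / p).toReal).toReal, fun φ => ?_⟩
  rw [Lp.norm_toLp, Lp.norm_def, ← ENNReal.toReal_mul]
  have hfin : C ^ (1 / p).toReal ≠ ∞ := ENNReal.rpow_ne_top_of_nonneg ENNReal.toReal_nonneg hC
  refine ENNReal.toReal_mono (ENNReal.mul_ne_top hfin (Lp.eLpNorm_ne_top φ)) ?_
  have hm : AEStronglyMeasurable φ (μ.map f) :=
    ((Lp.memLp φ).of_measure_le_smul hC hle).aestronglyMeasurable
  rw [← eLpNorm_map_measure hm hf.measurable.aemeasurable]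
  exact eLpNorm_le_of_measure_le_smul hle

/-- The composition operator `T_f : φ ↦ φ ∘ f` as a continuous linear operator on `L^p(μ)`. -/
noncomputable def compOp (𝕜 : Type*) [RCLike 𝕜] (p : ℝ≥0∞) [Fact (1 ≤ p)] (μ : Measure X)
    (f : X → X) (hf : IsBimeasurable f) (hc : HasLowerImageBound μ f) :
    Lp 𝕜 p μ →L[𝕜] Lp 𝕜 p μ :=
  LinearMap.mkContinuousOfExistsBound
    { toFun := fun φ => (hc.memLp_comp hf (Lp.memLp φ)).toLp (φ ∘ f)
      map_add' := fun φ ψ => by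
        rw [← MemLp.toLp_add, MemLp.toLp_eq_toLp_iff]
        exact (hc.quasiMeasurePreserving hf).ae_eq_comp (Lp.coeFn_add φ ψ)
      map_smul' := fun a φ => by
        rw [RingHom.id_apply, ← MemLp.toLp_const_smul, MemLp.toLp_eq_toLp_iff]
        exact (hc.quasiMeasurePreserving hf).ae_eq_comp (Lp.coeFn_smul a φ) }
    (hc.exists_norm_bound hf)

theorem compOp_coeFn [Fact (1 ≤ p)] (hf : IsBimeasurable f) (hc : HasLowerImageBound μ f) (φ : Lp 𝕜 p μ) :
    compOp 𝕜 p μ f hf hc φ =ᵐ[μ] φ ∘ f :=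
  MemLp.coeFn_toLp (hc.memLp_comp hf (Lp.memLp φ))

end CompOp

/-!
Dense Li-Yorke chaos and transitivity of the composition operator are both equivalent to the
condition `IsEscaping μ f`: for every `ε ≠ 0` some iterate
`f^[n]` maps a set whose complement has measure at most `ε` onto a set of measure at most `ε`.

*Necessity.* Transitivity gives a vector near the constant `0` with an iterate near the constant
`1`. A dense scrambled set contains two points whose difference is near `1`, and this difference has
iterates near `0`. In both cases Chebyshev's inequality
(`isEscaping_of_forall_exists_edist_le`) produces the sets in the escape condition.

*Sufficiency.* Everything follows from a shadowing property (`IsEscaping.exists_shadowing`). The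
escape condition gives times `m 0 < m 1 < ...` and sets `A j` of almost full measure with images
`Q j = f^[m j] '' A j` so small that even their preimages under the earlier `f^[m i]` are negligible
(`IsEscaping.exists_seq`). Given uniformly bounded `z` and `g j`, let `w` be `g j ∘ (f^[m j])⁻¹` on
the part of `Q j` not covered by later images, for `j ≥ K`, and `z` elsewhere. Since `w` is bounded
and differs from `z` only on a small set, it is close to `z` in `Lp`; since `w ∘ f^[m j] = g j` off
a small set, the `m j`-th iterate of `w` is asymptotic to `g j`.

With `g j` constantly equal to a given bounded function this is transitivity. For Li-Yorke chaos,
`g j` runs cyclically through `0`, `z` and the constant `c`, where `z` ranges over the simple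
functions and `c` over the positive reals, and `w` is taken within `c` of `z`. The pair `(z, c)` can
be read off from limits along the orbit of `w`, so that distinct pairs yield Li-Yorke pairs, while
letting `c → 0` gives density. No separability of `Lp` is needed.
-/

/-! ### Iterates of the map and the escape condition -/

section Escape

variable {X : Type*} [MeasurableSpace X] {μ : Measure X} {f : X → X}

theorem IsBimeasurable.measurableEmbedding_iterate (hf : IsBimeasurable f)
    (hinj : Function.Injective f) (n : ℕ) : MeasurableEmbedding f^[n] := by
  have h1 : MeasurableEmbedding f := ⟨hinj, hf.measurable, fun s hs => (hf s hs).1⟩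
  induction n with
  | zero => exact MeasurableEmbedding.id
  | succ n ih => exact ih.comp h1

theorem HasLowerImageBound.exists_measure_preimage_iterate_le (hf : IsBimeasurable f)
    (hc : HasLowerImageBound μ f) :
    ∃ C : ℝ≥0∞, C ≠ ∞ ∧ ∀ (n : ℕ) (Q : Set X), MeasurableSet Q →
      μ (f^[n] ⁻¹' Q) ≤ C ^ n * μ Q := by
  obtain ⟨C, hC, hle⟩ := hc.exists_map_le hf
  refine ⟨C, hC, fun n => ?_⟩
  induction n with
  | zero => intro Q _; simp
  | succ n ih =>
    intro Q hQ
    have h1 : μ (f ⁻¹' Q) ≤ C * μ Q := by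
      rw [← Measure.map_apply hf.measurable hQ]
      simpa using hle Q
    rw [Function.iterate_succ', Set.preimage_comp, pow_succ, mul_assoc]
    exact (ih _ (hf.measurable hQ)).trans (by gcongr)

theorem HasLowerImageBound.exists_forall_measure_preimage_iterate_le (hf : IsBimeasurable f)
    (hc : HasLowerImageBound μ f) (N : ℕ) {ε : ℝ≥0∞} (hε : ε ≠ 0) :
    ∃ δ : ℝ≥0∞, δ ≠ 0 ∧ ∀ Q : Set X, MeasurableSet Q → μ Q ≤ δ →
      ∀ i < N, μ (f^[i] ⁻¹' Q) ≤ ε := by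
  obtain ⟨C, hC, h⟩ := hc.exists_measure_preimage_iterate_le hf
  have hD : max C 1 ^ N ≠ ∞ := ENNReal.pow_ne_top (by simp [hC])
  refine ⟨ε / max C 1 ^ N, ENNReal.div_ne_zero.2 ⟨hε, hD⟩, fun Q hQ hQδ i hi => ?_⟩
  calc μ (f^[i] ⁻¹' Q) ≤ C ^ i * μ Q := h i Q hQ
    _ ≤ max C 1 ^ i * μ Q := by gcongr; exact le_max_left _ _
    _ ≤ max C 1 ^ N * (ε / max C 1 ^ N) := by
        gcongr
        exact le_max_right _ _
    _ ≤ ε := ENNReal.mul_div_le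

/-- Some iterate of `f` squeezes almost all of the space into a set of arbitrarily small measure.
This is the measure-theoretic condition to which both density of Li-Yorke chaos and transitivity of
the composition operator are equivalent. -/
def IsEscaping (μ : Measure X) (f : X → X) : Prop :=
  ∀ ε : ℝ≥0∞, ε ≠ 0 → ∃ (n : ℕ) (A : Set X), MeasurableSet A ∧ μ Aᶜ ≤ ε ∧ μ (f^[n] '' A) ≤ ε

variable [IsFiniteMeasure μ]

/-- The time in the escape condition can be taken past any `N`, and the small image then has small
preimages under all iterates before `N`. -/
theorem IsEscaping.exists_ge (hμ : μ Set.univ ≠ 0) (hf : IsBimeasurable f)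
    (hc : HasLowerImageBound μ f) (hinj : Function.Injective f) (h : IsEscaping μ f)
    (N : ℕ) {ε : ℝ≥0∞} (hε : ε ≠ 0) :
    ∃ (n : ℕ) (A : Set X), N ≤ n ∧ MeasurableSet A ∧ μ Aᶜ ≤ ε ∧
      ∀ i < N, μ (f^[i] ⁻¹' (f^[n] '' A)) ≤ ε := by
  set a := μ Set.univ
  have ha2 : a / 2 / 2 ≠ 0 := by simp [hμ]
  have hε' : min ε (a / 2 / 2) ≠ 0 := (lt_min hε.bot_lt ha2.bot_lt).ne'
  obtain ⟨δ, hδ, hδQ⟩ := hc.exists_forall_measure_preimage_iterate_le hf N hε'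
  obtain ⟨n, A, hA, hAc, hQ⟩ := h (min (min ε (a / 2 / 2)) δ) (lt_min hε'.bot_lt hδ.bot_lt).ne'
  have hQm : MeasurableSet (f^[n] '' A) :=
    (hf.measurableEmbedding_iterate hinj n).measurableSet_image.2 hA
  have key := hδQ _ hQm (hQ.trans (min_le_right _ _))
  refine ⟨n, A, ?_, hA, hAc.trans ((min_le_left _ _).trans (min_le_left _ _)),
    fun i hi => (key i hi).trans (min_le_left _ _)⟩
  -- For `n < N`, both `A` and its complement would have at most a quarter of the total measure.
  by_contra! hn
  have h1 : μ A ≤ a / 2 / 2 :=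
    (measure_mono (Set.subset_preimage_image _ _)).trans ((key n hn).trans (min_le_right _ _))
  have h2 : μ Aᶜ ≤ a / 2 / 2 := hAc.trans ((min_le_left _ _).trans (min_le_right _ _))
  have h3 : a ≤ a / 2 :=
    calc a = μ A + μ Aᶜ := (measure_add_measure_compl hA).symm
      _ ≤ a / 2 / 2 + a / 2 / 2 := add_le_add h1 h2
      _ = a / 2 := ENNReal.add_halves _
  exact absurd h3 (not_le.2 (ENNReal.half_lt_self hμ (measure_ne_top _ _)))

/-- Times `m 0 < m 1 < ...` and sets `A j` of almost full measure whose images `Q j` under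
`f^[m j]` are negligible, also when viewed from the earlier times. -/
theorem IsEscaping.exists_seq (hμ : μ Set.univ ≠ 0) (hf : IsBimeasurable f)
    (hc : HasLowerImageBound μ f) (hinj : Function.Injective f) (h : IsEscaping μ f)
    {ε : ℕ → ℝ≥0∞} (hε : ∀ j, ε j ≠ 0) :
    ∃ (m : ℕ → ℕ) (A : ℕ → Set X), StrictMono m ∧ ∀ j, MeasurableSet (A j) ∧ μ (A j)ᶜ ≤ ε j ∧
      μ (f^[m j] '' A j) ≤ ε j ∧ ∀ i < j, μ (f^[m i] ⁻¹' (f^[m j] '' A j)) ≤ ε j := by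
  choose n A hn hA hAc hQ using fun N j => h.exists_ge hμ hf hc hinj N (hε j)
  -- `N j` is one more than the previously chosen time.
  let N : ℕ → ℕ := fun j => Nat.rec 1 (fun j N => n N j + 1) j
  have hN : ∀ j, N (j + 1) = n (N j) j + 1 := fun _ => rfl
  have hNm : StrictMono N := strictMono_nat_of_lt_succ fun j => by
    have := hn (N j) j
    have := hN j
    omega
  have hN0 : ∀ j, 0 < N j := fun j => lt_of_lt_of_le Nat.one_pos (hNm.monotone j.zero_le)
  refine ⟨fun j => n (N j) j, fun j => A (N j) j, strictMono_nat_of_lt_succ fun j => ?_, fun j =>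
    ⟨hA _ _, hAc _ _, by simpa using hQ _ _ 0 (hN0 j), fun i hi => hQ _ _ _ ?_⟩⟩
  · have := hn (N (j + 1)) (j + 1)
    have := hN j
    omega
  · have := hNm.monotone (Nat.succ_le_of_lt hi)
    have := hN i
    simp only [Nat.succ_eq_add_one] at *
    omega

end Escape

/-! ### Estimates in `Lp` -/

section Estimates

variable {X : Type*} [MeasurableSpace X] {μ : Measure X} {f : X → X} {𝕜 : Type*} [RCLike 𝕜]
  {p : ℝ≥0∞}

/-- Bounded functions that agree off a small set are close in `Lp`. -/
theorem edist_Lp_le_of_ae_eq_off {φ ψ : Lp 𝕜 p μ} {M : ℝ} {E : Set X}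
    (hφ : ∀ᵐ x ∂μ, ‖φ x‖ ≤ M) (hψ : ∀ᵐ x ∂μ, ‖ψ x‖ ≤ M)
    (h : ∀ᵐ x ∂μ, x ∉ E → φ x = ψ x) :
    edist φ ψ ≤ ‖2 * M‖ₑ * μ E ^ (1 / p.toReal) := by
  rw [Lp.edist_def]
  refine le_trans (eLpNorm_mono_ae ?_) (eLpNorm_indicator_const_le (s := E) (c := 2 * M) p)
  filter_upwards [hφ, hψ, h] with x h1 h2 h3
  by_cases hx : x ∈ E
  · rw [Set.indicator_of_mem hx, Pi.sub_apply]
    calc ‖φ x - ψ x‖ ≤ ‖φ x‖ + ‖ψ x‖ := norm_sub_le _ _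
      _ ≤ 2 * M := by linarith
      _ ≤ ‖2 * M‖ := Real.le_norm_self _
  · simp [Set.indicator_of_notMem hx, h3 hx]

theorem exists_measurable_norm_le_ae_eq (φ : Lp 𝕜 p μ) {M : ℝ} (hM : 0 ≤ M)
    (h : ∀ᵐ x ∂μ, ‖φ x‖ ≤ M) :
    ∃ g : X → 𝕜, Measurable g ∧ (∀ x, ‖g x‖ ≤ M) ∧ φ =ᵐ[μ] g := by
  have hm : Measurable φ := (Lp.stronglyMeasurable φ).measurable
  refine ⟨{x | ‖φ x‖ ≤ M}.indicator φ, hm.indicator (measurableSet_le hm.norm measurable_const),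
    fun x => ?_, ?_⟩
  · by_cases hx : ‖φ x‖ ≤ M
    · rwa [Set.indicator_of_mem (by exact hx)]
    · rwa [Set.indicator_of_notMem (by exact hx), norm_zero]
  · filter_upwards [h] with x hx
    rw [Set.indicator_of_mem (by exact hx)]

variable [Fact (1 ≤ p)]

theorem compOp_iterate_coeFn (hf : IsBimeasurable f) (hc : HasLowerImageBound μ f) (n : ℕ)
    (φ : Lp 𝕜 p μ) : (compOp 𝕜 p μ f hf hc)^[n] φ =ᵐ[μ] φ ∘ f^[n] := by
  induction n with
  | zero => rfl
  | succ n ih =>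
    rw [Function.iterate_succ_apply', Function.iterate_succ, ← Function.comp_assoc]
    exact (compOp_coeFn hf hc _).trans ((hc.quasiMeasurePreserving hf).ae_eq_comp ih)

/-- Chebyshev's inequality: functions close in `Lp` are within `1 / 2` of each other off a small
set. -/
theorem exists_forall_measure_le_of_edist_Lp_le (hp : p ≠ ∞) {ε : ℝ≥0∞} (hε : ε ≠ 0) :
    ∃ δ : ℝ≥0∞, δ ≠ 0 ∧ ∀ φ ψ : Lp 𝕜 p μ, edist φ ψ ≤ δ →
      μ {x | 2⁻¹ ≤ edist (φ x) (ψ x)} ≤ ε := by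
  have hp0 : p ≠ 0 := (lt_of_lt_of_le zero_lt_one (Fact.out : 1 ≤ p)).ne'
  have hpp : 0 < p.toReal := ENNReal.toReal_pos hp0 hp
  refine ⟨2⁻¹ * ε ^ (1 / p.toReal), ?_, fun φ ψ h => ?_⟩
  · simp only [ne_eq, mul_eq_zero, not_or]
    refine ⟨by simp, ?_⟩
    rw [ENNReal.rpow_eq_zero_iff]
    rintro (⟨h, -⟩ | ⟨-, h⟩)
    · exact hε h
    · exact absurd h (not_lt.2 (by positivity))
  · have h1 := meas_ge_le_mul_pow_eLpNorm_enorm μ hp0 hp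
      (f := ⇑φ - ⇑ψ) ((Lp.aestronglyMeasurable φ).sub (Lp.aestronglyMeasurable ψ))
      (ε := 2⁻¹) (by simp) (by simp)
    simp only [Pi.sub_apply, ← edist_eq_enorm_sub] at h1
    rw [← Lp.edist_def, inv_inv] at h1
    refine h1.trans ?_
    rw [← ENNReal.mul_rpow_of_nonneg _ _ hpp.le]
    calc (2 * edist φ ψ) ^ p.toReal ≤ (2 * (2⁻¹ * ε ^ (1 / p.toReal))) ^ p.toReal := by gcongr
      _ = ε := by
        rw [← mul_assoc, ENNReal.mul_inv_cancel (by simp) (by simp), one_mul, ← ENNReal.rpow_mul,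
          one_div_mul_cancel hpp.ne', ENNReal.rpow_one]

end Estimates

/-! ### Shadowing along a sequence of times -/

section Shadowing

variable {X : Type*} [MeasurableSpace X] {μ : Measure X} {f : X → X} {𝕜 : Type*} [RCLike 𝕜]

/-- A bounded function that equals `z` off the images `f^[m j] '' A j`, `j ≥ K`, and whose pullback
under `f^[m j]` is `g j` at those points of `A j` that are not sent into a later image. On each
image, the last index takes priority. -/
theorem exists_measurable_eq_comp_iterate (hf : IsBimeasurable f) (hinj : Function.Injective f)
    (m : ℕ → ℕ) {A : ℕ → Set X} (hA : ∀ j, MeasurableSet (A j)) {M : ℝ} {g : ℕ → X → 𝕜}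
    (hg : ∀ j, Measurable (g j)) (hgM : ∀ j x, ‖g j x‖ ≤ M) {z : X → 𝕜} (hz : Measurable z)
    (hzM : ∀ x, ‖z x‖ ≤ M) (K : ℕ) :
    ∃ h : X → 𝕜, Measurable h ∧ (∀ x, ‖h x‖ ≤ M) ∧
      (∀ x, (∀ j ≥ K, x ∉ f^[m j] '' A j) → h x = z x) ∧
      ∀ j ≥ K, ∀ x ∈ A j, (∀ i > j, f^[m j] x ∉ f^[m i] '' A i) → h (f^[m j] x) = g j x := by
  have he : ∀ n, MeasurableEmbedding f^[n] := hf.measurableEmbedding_iterate hinj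
  have hQ : ∀ j, MeasurableSet (f^[m j] '' A j) := fun j => (he _).measurableSet_image.2 (hA j)
  let P : ℕ → Set X := fun j => {x | K ≤ j ∧ x ∈ f^[m j] '' A j ∧ ∀ i > j, x ∉ f^[m i] '' A i}
  have hP : ∀ j, MeasurableSet (P j) := fun j => by
    refine (MeasurableSet.const _).inter ((hQ j).inter ?_)
    change MeasurableSet {x | ∀ i > j, x ∉ f^[m i] '' A i}
    simp only [Set.ofPred_forall]
    exact .iInter fun i => .iInter fun _ => (hQ i).compl
  have hPd : ∀ i j x, x ∈ P i → x ∈ P j → i = j := fun i j x hi hj => by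
    rcases lt_trichotomy i j with h | h | h
    · exact absurd hj.2.1 (hi.2.2 j h)
    · exact h
    · exact absurd hi.2.1 (hj.2.2 i h)
  let G : ℕ → X → 𝕜 := fun j => Function.extend f^[m j] (g j) z
  have hG : ∀ j, Measurable (G j) := fun j => (he _).measurable_extend (hg j) hz
  have hGM : ∀ j x, ‖G j x‖ ≤ M := fun j x => by
    by_cases hx : ∃ y, f^[m j] y = x
    · obtain ⟨y, rfl⟩ := hx
      simpa only [G, (he _).injective.extend_apply] using hgM j y
    · simpa only [G, Function.extend_apply' _ _ _ hx] using hzM x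
  obtain ⟨h, hm, hh⟩ := exists_measurable_piecewise
    (fun o : Option ℕ => o.elim (⋃ j, P j)ᶜ P) (by
      rintro (_ | j)
      exacts [(MeasurableSet.iUnion hP).compl, hP j])
    (fun o : Option ℕ => o.elim z G) (by rintro (_ | j); exacts [hz, hG j]) (by
      rintro (_ | i) (_ | j) hij x ⟨hxi, hxj⟩
      · exact absurd rfl hij
      · exact absurd (Set.mem_iUnion_of_mem j hxj) hxi
      · exact absurd (Set.mem_iUnion_of_mem i hxi) hxj
      · exact absurd (congrArg some (hPd i j x hxi hxj)) hij)
  have hnone : ∀ x, (∀ j, x ∉ P j) → h x = z x := fun x hx => hh none (by simpa using hx)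
  have hsome : ∀ j, ∀ x ∈ P j, h x = G j x := fun j x hx => hh (some j) hx
  refine ⟨h, hm, fun x => ?_, fun x hx => hnone x fun j hj => hx j hj.1 hj.2.1,
    fun j hj x hx hi => ?_⟩
  · by_cases hx : ∃ j, x ∈ P j
    · obtain ⟨j, hj⟩ := hx
      exact hsome j x hj ▸ hGM j x
    · push Not at hx
      exact hnone x hx ▸ hzM x
  · rw [hsome j _ ⟨hj, Set.mem_image_of_mem _ hx, hi⟩]
    exact (he _).injective.extend_apply _ _ _

variable [IsFiniteMeasure μ] {p : ℝ≥0∞} [Fact (1 ≤ p)]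

/-- Along a fixed sequence of times, the orbit of a vector arbitrarily close to any bounded `z` can
be made asymptotic to any prescribed uniformly bounded sequence of functions. -/
theorem IsEscaping.exists_shadowing (hμ : μ Set.univ ≠ 0) (hf : IsBimeasurable f)
    (hc : HasLowerImageBound μ f) (hinj : Function.Injective f) (hp : p ≠ ∞)
    (h : IsEscaping μ f) :
    ∃ m : ℕ → ℕ, StrictMono m ∧ ∀ (M : ℝ) (g : ℕ → Lp 𝕜 p μ) (z : Lp 𝕜 p μ),
      (∀ j, ∀ᵐ x ∂μ, ‖g j x‖ ≤ M) → (∀ᵐ x ∂μ, ‖z x‖ ≤ M) → ∀ ε : ℝ≥0∞, ε ≠ 0 →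
      ∃ w : Lp 𝕜 p μ, edist w z < ε ∧
        Tendsto (fun j => edist ((compOp 𝕜 p μ f hf hc)^[m j] w) (g j)) atTop (nhds 0) := by
  obtain ⟨ε', hε', hsum⟩ := ENNReal.exists_pos_sum_of_countable' (ε := 1) one_ne_zero ℕ
  obtain ⟨m, A, hm, hA⟩ := h.exists_seq hμ hf hc hinj fun j => (hε' j).ne'
  refine ⟨m, hm, fun M g z hg hz ε hε => ?_⟩
  have hM : 0 ≤ M := by
    have : NeZero μ := ⟨fun h0 => hμ (by simp [h0])⟩
    obtain ⟨x, hx⟩ := hz.exists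
    exact (norm_nonneg _).trans hx
  have hpp : 0 < 1 / p.toReal := one_div_pos.2 <|
    ENNReal.toReal_pos (lt_of_lt_of_le zero_lt_one (Fact.out : 1 ≤ p)).ne' hp
  -- `τ j` bounds the measure of the exceptional sets at time `m j`.
  let τ : ℕ → ℝ≥0∞ := fun j => ∑' k, ε' (k + j)
  have hτ : Tendsto τ atTop (nhds 0) :=
    ENNReal.tendsto_sum_nat_add ε' (hsum.trans ENNReal.one_lt_top).ne
  have hτ' : Tendsto (fun j => ‖2 * M‖ₑ * τ j ^ (1 / p.toReal)) atTop (nhds 0) := by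
    have h1 := (ENNReal.continuous_rpow_const (y := 1 / p.toReal)).tendsto 0 |>.comp hτ
    rw [ENNReal.zero_rpow_of_pos hpp] at h1
    simpa using ENNReal.Tendsto.const_mul h1 (Or.inr (enorm_ne_top (x := 2 * M)))
  choose g' hg'm hg'M hg' using fun j => exists_measurable_norm_le_ae_eq (g j) hM (hg j)
  obtain ⟨z', hz'm, hz'M, hz'⟩ := exists_measurable_norm_le_ae_eq z hM hz
  obtain ⟨K, hK⟩ := (hτ'.eventually (gt_mem_nhds hε.bot_lt)).exists
  obtain ⟨w, hwm, hwM, hwz, hwg⟩ := exists_measurable_eq_comp_iterate hf hinj m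
    (fun j => (hA j).1) hg'm hg'M hz'm hz'M K
  have hwL : MemLp w p μ := MemLp.of_bound hwm.aestronglyMeasurable M (.of_forall hwM)
  have hw : hwL.toLp w =ᵐ[μ] w := hwL.coeFn_toLp
  refine ⟨hwL.toLp w, lt_of_le_of_lt ?_ hK, ?_⟩
  · refine (edist_Lp_le_of_ae_eq_off (M := M) (E := ⋃ k, f^[m (k + K)] '' A (k + K))
      ?_ hz ?_).trans ?_
    · filter_upwards [hw] with x hx
      exact hx ▸ hwM x
    · filter_upwards [hw, hz'] with x h1 h2 hx
      rw [h1, h2]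
      refine hwz x fun j hj hxj => hx (Set.mem_iUnion.2 ⟨j - K, ?_⟩)
      rwa [Nat.sub_add_cancel hj]
    · gcongr
      exact (measure_iUnion_le _).trans (ENNReal.tsum_le_tsum fun k => (hA _).2.2.1)
  · refine tendsto_of_tendsto_of_tendsto_of_le_of_le' tendsto_const_nhds hτ'
      (.of_forall fun _ => zero_le) ((eventually_ge_atTop K).mono fun j hj => ?_)
    have hTw : (compOp 𝕜 p μ f hf hc)^[m j] (hwL.toLp w) =ᵐ[μ] w ∘ f^[m j] := by
      have hq := (hc.quasiMeasurePreserving hf).iterate (m j)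
      exact (compOp_iterate_coeFn hf hc _ _).trans (hq.ae_eq_comp hw)
    refine (edist_Lp_le_of_ae_eq_off (M := M)
      (E := (A j)ᶜ ∪ ⋃ k, f^[m j] ⁻¹' (f^[m (k + 1 + j)] '' A (k + 1 + j))) ?_ (hg j) ?_).trans ?_
    · filter_upwards [hTw] with x hx
      exact hx ▸ hwM _
    · filter_upwards [hTw, hg' j] with x h1 h2 hx
      simp only [Set.mem_union, Set.mem_compl_iff, not_or, not_not, Set.mem_iUnion,
        Set.mem_preimage, not_exists] at hx
      rw [h1, h2]
      refine hwg j hj x hx.1 fun i hi => ?_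
      have := hx.2 (i - j - 1)
      rwa [show i - j - 1 + 1 + j = i by omega] at this
    · gcongr
      calc _ ≤ μ (A j)ᶜ + ∑' k, μ (f^[m j] ⁻¹' (f^[m (k + 1 + j)] '' A (k + 1 + j))) :=
            (measure_union_le _ _).trans (by gcongr; exact measure_iUnion_le _)
        _ ≤ ε' (0 + j) + ∑' k, ε' (k + 1 + j) := by
            refine add_le_add (by simpa using (hA j).2.1) (ENNReal.tsum_le_tsum fun k => ?_)
            exact (hA _).2.2.2 j (by omega)
        _ = τ j := (tsum_eq_zero_add' (f := fun k => ε' (k + j)) ENNReal.summable).symm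

end Shadowing

/-! ### The equivalence -/

section Equivalence

variable {X : Type*} [MeasurableSpace X] {μ : Measure X} {f : X → X} {𝕜 : Type*} [RCLike 𝕜]
  {p : ℝ≥0∞}

theorem IsLiYorkePair.of_tendsto {M : Type*} [MetricSpace M] {g : M → M} {x y : M}
    {k l : ℕ → ℕ} (hk : Tendsto k atTop atTop) (hl : Tendsto l atTop atTop) {d : ℝ≥0∞}
    (hd : d ≠ 0)
    (h0 : Tendsto (fun j => edist (g^[k j] x) (g^[k j] y)) atTop (nhds 0))
    (h1 : Tendsto (fun j => edist (g^[l j] x) (g^[l j] y)) atTop (nhds d)) :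
    IsLiYorkePair g x y := by
  set u : ℕ → ℝ≥0∞ := fun n => edist (g^[n] x) (g^[n] y)
  refine ⟨le_antisymm ?_ zero_le, hd.bot_lt.trans_le ?_⟩
  · calc liminf u atTop ≤ liminf u (map k atTop) := liminf_le_liminf_of_le hk
      _ = 0 := Tendsto.liminf_eq (f := map k atTop) (tendsto_map'_iff.2 h0)
  · calc d = limsup u (map l atTop) :=
          (Tendsto.limsup_eq (u := u) (f := map l atTop) (tendsto_map'_iff.2 h1)).symm
      _ ≤ limsup u atTop := limsup_le_limsup_of_le hl

theorem exists_ae_norm_le_of_mem_simpleFunc {φ : Lp 𝕜 p μ} (hφ : φ ∈ Lp.simpleFunc 𝕜 p μ) :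
    ∃ M : ℝ, ∀ᵐ x ∂μ, ‖φ x‖ ≤ M := by
  obtain ⟨M, hM⟩ := (Lp.simpleFunc.toSimpleFunc ⟨φ, hφ⟩).exists_forall_norm_le
  refine ⟨M, ?_⟩
  filter_upwards [Lp.simpleFunc.toSimpleFunc_eq_toFun ⟨φ, hφ⟩] with x hx
  exact hx ▸ hM x

variable [Fact (1 ≤ p)]

/-- If vectors close to a constant `a` have iterates close to a constant `b` at distance one, then
`f` is escaping: the small image is contained in the set where the vector is closer to `b` than to
`a`. -/
theorem isEscaping_of_forall_exists_edist_le [IsFiniteMeasure μ] (hf : IsBimeasurable f)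
    (hc : HasLowerImageBound μ f) (hp : p ≠ ∞) {a b : 𝕜} (hab : edist a b = 1)
    (h : ∀ δ : ℝ≥0∞, δ ≠ 0 → ∃ (φ : Lp 𝕜 p μ) (n : ℕ), edist φ (Lp.const p μ a) ≤ δ ∧
      edist ((compOp 𝕜 p μ f hf hc)^[n] φ) (Lp.const p μ b) ≤ δ) :
    IsEscaping μ f := by
  intro ε hε
  obtain ⟨δ, hδ, hδε⟩ := exists_forall_measure_le_of_edist_Lp_le (𝕜 := 𝕜) (μ := μ) hp hε
  obtain ⟨φ, n, h1, h2⟩ := h δ hδ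
  have hm : Measurable φ := (Lp.stronglyMeasurable φ).measurable
  refine ⟨n, {x | edist (φ (f^[n] x)) b < 2⁻¹}, ?_, ?_, ?_⟩
  · exact measurableSet_lt ((hm.comp (hf.measurable.iterate n)).edist measurable_const)
      measurable_const
  · refine (measure_mono_ae ?_).trans (hδε _ _ h2)
    filter_upwards [compOp_iterate_coeFn hf hc n φ, Lp.coeFn_const (p := p) (μ := μ) b]
      with x hx hb hxA
    change 2⁻¹ ≤ edist _ _
    rw [hx, hb]
    exact not_lt.1 hxA
  · refine (measure_mono_ae ?_).trans (hδε _ _ h1)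
    filter_upwards [Lp.coeFn_const (p := p) (μ := μ) a] with y ha hy
    obtain ⟨x, hx, rfl⟩ := hy
    change 2⁻¹ ≤ edist _ _
    rw [ha, Function.const_apply]
    by_contra! hlt
    have h3 : edist a b ≤ edist a (φ (f^[n] x)) + edist (φ (f^[n] x)) b := edist_triangle _ _ _
    rw [hab, edist_comm] at h3
    exact absurd h3 (not_le.2 ((ENNReal.add_lt_add hlt hx).trans_eq ENNReal.inv_two_add_inv_two))

variable [IsFiniteMeasure μ]

theorem IsTopTransitive.isEscaping (hf : IsBimeasurable f) (hc : HasLowerImageBound μ f)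
    (hp : p ≠ ∞) (h : IsTopTransitive (compOp 𝕜 p μ f hf hc)) : IsEscaping μ f := by
  refine isEscaping_of_forall_exists_edist_le (a := (0 : 𝕜)) (b := 1) hf hc hp
    (by simp [edist_eq_enorm_sub]) fun δ hδ => ?_
  obtain ⟨n, _, ⟨φ, hφ, rfl⟩, h2⟩ := h (Metric.eball (Lp.const p μ 0) δ)
    (Metric.eball (Lp.const p μ 1) δ) Metric.isOpen_eball
    ⟨_, Metric.mem_eball_self hδ.bot_lt⟩ Metric.isOpen_eball
    ⟨_, Metric.mem_eball_self hδ.bot_lt⟩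
  exact ⟨φ, n, (Metric.mem_eball.1 hφ).le, (Metric.mem_eball.1 h2).le⟩

/-- Density of the scrambled set gives two of its points whose difference is close to `1`; the
difference has iterates close to `0`. -/
theorem IsDenselyLiYorkeChaotic.isEscaping (hμ : μ Set.univ ≠ 0) (hf : IsBimeasurable f)
    (hc : HasLowerImageBound μ f) (hp : p ≠ ∞)
    (h : IsDenselyLiYorkeChaotic (compOp 𝕜 p μ f hf hc)) : IsEscaping μ f := by
  refine isEscaping_of_forall_exists_edist_le (a := (1 : 𝕜)) (b := 0) hf hc hp
    (by simp [edist_eq_enorm_sub]) fun δ hδ => ?_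
  obtain ⟨S, ⟨-, hS⟩, hd⟩ := h
  set T := compOp 𝕜 p μ f hf hc
  have hne : (Lp.const p μ (1 : 𝕜)) ≠ 0 := by
    have : NeZero μ := ⟨fun h0 => hμ (by simp [h0])⟩
    intro h0
    obtain ⟨x, h1, h2⟩ := ((Lp.coeFn_const (p := p) (μ := μ) (1 : 𝕜)).and
      (Lp.coeFn_zero 𝕜 p μ)).exists
    rw [h0, h2] at h1
    simp at h1
  -- Taking the radius below half the norm of `1` makes the two points distinct.
  obtain ⟨r, hr, hrδ⟩ : ∃ r : ℝ≥0∞, r ≠ 0 ∧ r + r ≤ δ ∧ r + r ≤ edist (Lp.const p μ (1 : 𝕜)) 0 :=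
    ⟨min δ (edist (Lp.const p μ (1 : 𝕜)) 0) / 2, by
      simp [hδ, hne], by rw [ENNReal.add_halves]; exact ⟨min_le_left _ _, min_le_right _ _⟩⟩
  obtain ⟨x, hx, hxS⟩ := hd.inter_open_nonempty _ Metric.isOpen_eball
    ⟨_, Metric.mem_eball_self (x := Lp.const p μ (1 : 𝕜)) hr.bot_lt⟩
  obtain ⟨y, hy, hyS⟩ := hd.inter_open_nonempty _ Metric.isOpen_eball
    ⟨_, Metric.mem_eball_self (x := (0 : Lp 𝕜 p μ)) hr.bot_lt⟩
  rw [Metric.mem_eball] at hx hy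
  have hxy : x ≠ y := by
    rintro rfl
    refine absurd (edist_triangle_left (Lp.const p μ (1 : 𝕜)) 0 x) (not_le.2 ?_)
    exact (ENNReal.add_lt_add hx hy).trans_le hrδ.2
  have hlim := (hS x hxS y hyS hxy).1
  obtain ⟨n, hn⟩ : ∃ n, edist (T^[n] x) (T^[n] y) < δ :=
    (frequently_lt_of_liminf_lt (by isBoundedDefault) (hlim.trans_lt hδ.bot_lt)).exists
  refine ⟨x - y, n, ?_, ?_⟩
  · refine le_trans ?_ ((add_le_add hx.le hy.le).trans hrδ.1)
    calc edist (x - y) (Lp.const p μ 1) = edist (x - y) (Lp.const p μ 1 - 0) := by rw [sub_zero]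
      _ ≤ _ := by
        simp only [edist_eq_enorm_sub]
        rw [sub_sub_sub_comm]
        exact enorm_sub_le
  · rw [map_zero, iterate_map_sub, edist_zero_right, ← edist_eq_enorm_sub]
    exact hn.le

theorem IsEscaping.isTopTransitive (hμ : μ Set.univ ≠ 0) (hf : IsBimeasurable f)
    (hc : HasLowerImageBound μ f) (hinj : Function.Injective f) (hp : p ≠ ∞)
    (h : IsEscaping μ f) : IsTopTransitive (compOp 𝕜 p μ f hf hc) := by
  intro U V hU hUn hV hVn
  obtain ⟨m, -, hsh⟩ := h.exists_shadowing (𝕜 := 𝕜) hμ hf hc hinj hp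
  obtain ⟨φ, hφU, hφ⟩ := (Lp.simpleFunc.dense (E := 𝕜) (μ := μ) hp).inter_open_nonempty U hU hUn
  obtain ⟨ψ, hψV, hψ⟩ := (Lp.simpleFunc.dense (E := 𝕜) (μ := μ) hp).inter_open_nonempty V hV hVn
  obtain ⟨M₁, hM₁⟩ := exists_ae_norm_le_of_mem_simpleFunc hφ
  obtain ⟨M₂, hM₂⟩ := exists_ae_norm_le_of_mem_simpleFunc hψ
  obtain ⟨ε, hε, hεU⟩ := EMetric.isOpen_iff.1 hU φ hφU
  obtain ⟨w, hw, hlim⟩ := hsh (max M₁ M₂) (fun _ => ψ) φ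
    (fun _ => hM₂.mono fun _ h => h.trans (le_max_right _ _))
    (hM₁.mono fun _ h => h.trans (le_max_left _ _)) ε hε.ne'
  obtain ⟨j, hj⟩ := ((tendsto_iff_edist_tendsto_0.2 hlim).eventually (hV.mem_nhds hψV)).exists
  exact ⟨m j, _, ⟨w, hεU hw, rfl⟩, hj⟩

/-- The scrambled set consists of vectors `w (z, c)` for bounded `z` and `c > 0`, with `w (z, c)`
within `c` of `z` and with iterates approaching `0`, `z` and the constant `c` along three sequences
of times. -/
theorem IsEscaping.isDenselyLiYorkeChaotic (hμ : μ Set.univ ≠ 0) (hf : IsBimeasurable f)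
    (hc : HasLowerImageBound μ f) (hinj : Function.Injective f) (hp : p ≠ ∞)
    (h : IsEscaping μ f) : IsDenselyLiYorkeChaotic (compOp 𝕜 p μ f hf hc) := by
  obtain ⟨m, hm, hsh⟩ := h.exists_shadowing (𝕜 := 𝕜) hμ hf hc hinj hp
  set T := compOp 𝕜 p μ f hf hc
  have : NeZero μ := ⟨fun h0 => hμ (by simp [h0])⟩
  have hconst : ∀ c d : ℝ, Lp.const p μ (c : 𝕜) = Lp.const p μ (d : 𝕜) → c = d := fun c d hcd => by
    obtain ⟨x, h1, h2⟩ := ((Lp.coeFn_const (p := p) (μ := μ) (c : 𝕜)).and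
      (Lp.coeFn_const (p := p) (μ := μ) (d : 𝕜))).exists
    rw [hcd, h2] at h1
    simpa using h1.symm
  have hT : ∀ i : Lp.simpleFunc 𝕜 p μ × Set.Ioi (0 : ℝ), ∃ w : Lp 𝕜 p μ,
      edist w i.1 < ENNReal.ofReal i.2 ∧
      Tendsto (fun j => T^[m (3 * j)] w) atTop (nhds 0) ∧
      Tendsto (fun j => T^[m (3 * j + 1)] w) atTop (nhds i.1) ∧
      Tendsto (fun j => T^[m (3 * j + 2)] w) atTop (nhds (Lp.const p μ ((i.2 : ℝ) : 𝕜))) := by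
    rintro ⟨⟨z, hz⟩, c, hc0⟩
    obtain ⟨M, hM⟩ := exists_ae_norm_le_of_mem_simpleFunc hz
    have hc0' : (0 : ℝ) < c := hc0
    obtain ⟨w, hw, hlim⟩ := hsh (max M c)
      (fun j => if j % 3 = 0 then 0 else if j % 3 = 1 then z else Lp.const p μ (c : 𝕜)) z
      (fun j => by
        split_ifs
        · filter_upwards [Lp.coeFn_zero 𝕜 p μ] with x hx
          rw [hx]
          simpa using Or.inr hc0'.le
        · exact hM.mono fun _ h => h.trans (le_max_left _ _)
        · filter_upwards [Lp.coeFn_const (p := p) (μ := μ) (c : 𝕜)] with x hx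
          rw [hx]
          simp [abs_of_pos hc0'])
      (hM.mono fun _ h => h.trans (le_max_left _ _)) (ENNReal.ofReal c) (by simpa using hc0')
    have hsub : ∀ r, Tendsto (fun j => 3 * j + r) atTop atTop := fun r =>
      tendsto_atTop_mono (fun j => by rw [id]; omega) tendsto_id
    refine ⟨w, hw, ?_, ?_, ?_⟩ <;> rw [tendsto_iff_edist_tendsto_0]
    · simpa [Function.comp_def] using hlim.comp (hsub 0)
    · simpa [Function.comp_def, Nat.add_mod] using hlim.comp (hsub 1)
    · simpa [Function.comp_def, Nat.add_mod] using hlim.comp (hsub 2)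
  choose w hwz hw0 hw1 hw2 using hT
  have hmt : ∀ r, Tendsto (fun j => m (3 * j + r)) atTop atTop := fun r =>
    hm.tendsto_atTop.comp (tendsto_atTop_mono (fun j => by rw [id]; omega) tendsto_id)
  have hLY : ∀ i k, i ≠ k → IsLiYorkePair T (w i) (w k) := fun i k hik => by
    have h0 : Tendsto (fun j => edist (T^[m (3 * j)] (w i)) (T^[m (3 * j)] (w k))) atTop
        (nhds 0) := by simpa using (hw0 i).edist (hw0 k)
    by_cases h1 : i.1 = k.1
    · have h2 : (i.2 : ℝ) ≠ k.2 := fun h2 => hik (Prod.ext h1 (Subtype.ext h2))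
      exact .of_tendsto (hmt 0) (hmt 2) (edist_pos.2 fun e => h2 (hconst _ _ e)).ne' h0
        ((hw2 i).edist (hw2 k))
    · exact .of_tendsto (hmt 0) (hmt 1) (edist_pos.2 fun e => h1 (Subtype.ext e)).ne' h0
        ((hw1 i).edist (hw1 k))
  have hwinj : Function.Injective w := fun i k hik => by
    by_contra hne
    simpa [hik] using (hLY i k hne).2
  refine ⟨Set.range w, ⟨fun hcount => ?_, ?_⟩, ?_⟩
  · have h1 : Function.Injective fun c : Set.Ioi (0 : ℝ) => w (0, c) :=
      hwinj.comp fun c d h => (Prod.ext_iff.1 h).2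
    have h2 : (Set.range fun c : Set.Ioi (0 : ℝ) => w (0, c)).Countable :=
      hcount.mono (Set.range_subset_iff.2 fun c => Set.mem_range_self _)
    have h3 : Countable (Set.Ioi (0 : ℝ)) := by
      have := h2.to_subtype
      exact (Set.rangeFactorization_injective.2 h1).countable
    have h4 := Cardinal.mk_le_aleph0 (α := Set.Ioi (0 : ℝ))
    rw [Cardinal.mk_Ioi_real] at h4
    exact absurd h4 (not_le.2 Cardinal.aleph0_lt_continuum)
  · rintro _ ⟨i, rfl⟩ _ ⟨k, rfl⟩ hik
    exact hLY i k fun e => hik (e ▸ rfl)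
  · refine dense_iff_inter_open.2 fun U hU hUn => ?_
    obtain ⟨z, hzU, hz⟩ := (Lp.simpleFunc.dense (E := 𝕜) (μ := μ) hp).inter_open_nonempty U hU hUn
    obtain ⟨c, hc0, hcU⟩ := Metric.isOpen_iff.1 hU z hzU
    refine ⟨w (⟨z, hz⟩, ⟨c, hc0⟩), hcU ?_, Set.mem_range_self _⟩
    have := hwz (⟨z, hz⟩, ⟨c, hc0⟩)
    rwa [edist_lt_ofReal] at this

end Equivalence

theorem mainTheorem7 {X : Type*} [MeasurableSpace X] (μ : Measure X) [IsFiniteMeasure μ]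
    (hμ : μ Set.univ ≠ 0) (f : X → X) (hf : IsBimeasurable f) (hc : HasLowerImageBound μ f)
    (hinj : Function.Injective f) (𝕜 : Type*) [RCLike 𝕜] (p : ℝ≥0∞) [Fact (1 ≤ p)]
    (hp : p ≠ ∞) :
    IsDenselyLiYorkeChaotic (compOp 𝕜 p μ f hf hc) ↔
      IsTopTransitive (compOp 𝕜 p μ f hf hc) :=
  ⟨fun h => (h.isEscaping hμ hf hc hp).isTopTransitive hμ hf hc hinj hp,
    fun h => (h.isEscaping hf hc hp).isDenselyLiYorkeChaotic hμ hf hc hinj hp⟩
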